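/- All vertex operator algebras are over $\mathbb{C}$, with vacuum vector $\mathbf 1$, Virasoro vector $\omega$ (both nonzero), vertex operators $Y(v,z)=\sum_{n\in\mathbb{Z}}v_{(n)}z^{-n-1}$, $L_n=\omega_{(n+1)}$, and grading $V=\bigoplus_{n\ge 0}V_n$ by the eigenspaces of $L_0$, with $\dim V_n<\infty$ and $V_0=\mathbb{C}\mathbf 1$. It is assumed that $V=\bigoplus_{i}M_i$ is a direct sum of highest weight modules for the Virasoro algebra, where $M_i$ is a nonzero quotient of a Verma module $M(c,h_i)$ with $h_i\in\mathbb{Z}_{\ge 0}$; let $\overline M(h)$ be the sum of the $M_i$ with $h_i=h$, and let $\pi:V\to\overline M(0)$ be the projection with kernel $\bigoplus_{h>0}\overline M(h)$. For $v\in V_n$ put $\mathrm{o}(v)=v_{(n-1)}$. The space $V_2$ is called a conformal $6$-design if $\mathrm{tr}|_{V_2}\,\mathrm{o}(v)=\mathrm{tr}|_{V_2}\,\mathrm{o}(\pi(v))$ for all $v\in V_n$ with $0\le n\le 6$. **Proposition (Matsuo).** Let $V$ be such a vertex operator algebra, of central charge $c\in\mathbb{C}$ with $$c\neq -24,\ -15,\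 -\tfrac{44}{5},\ \tfrac{34}{35},\ \tfrac{55\pm\sqrt{33}}{2},\ 1,$$ and with $V_1=0$. Suppose that $V$ contains elements $\omega',\ \omega-\omega'\in V_2$ generating two commuting Virasoro vertex operator algebras of central charge $e$ and $c-e$, respectively, with $e,\ c-e\neq -\frac{68}{7},\ -\frac{22}{5},\ 0$. If $e=\frac12$, assume in addition that the Virasoro vertex operator algebra generated by $\omega'$ is simple; if $e=c-\frac12$, assume in addition that the one generated by $\omega-\omega'$ is simple. If $V_2$ is a conformal $6$-design, then $$\dim V_2=\frac{c\,(2388+955\,c+70\,c^2)}{2\,(748-55\,c+c^2)}.$$ -/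

import Mathlib

noncomputable section

open VertexOperator

/-- A vertex algebra structure on a complex vector space `V`: a state-field map
`Y(v, z) = ∑ v₍ₙ₎ z ^ (-n-1)` with values in vertex operators (so `u₍ₙ₎ v = 0` for `n` large), and a
vacuum vector, subject to the vacuum, creation and Borcherds (component Jacobi) identities. -/
structure VertexAlgebra (V : Type*) [AddCommGroup V] [Module ℂ V] where
  /-- the state-field correspondence -/
  Y : V →ₗ[ℂ] VertexOperator ℂ V
  /-- the vacuum vector -/
  vac : V
  vac_ne_zero : vac ≠ 0
  /-- the vacuum acts by `1₍₋₁₎ = id` and `1₍ₙ₎ = 0` for `n ≠ -1` -/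
  vac_mode : ∀ n : ℤ, ncoeff (Y vac) n = if n = -1 then LinearMap.id else 0
  /-- `u₍ₙ₎ 1 = 0` for `n ≥ 0` -/
  mode_vac : ∀ (u : V) (n : ℤ), 0 ≤ n → ncoeff (Y u) n vac = 0
  /-- `u₍₋₁₎ 1 = u` -/
  mode_neg_one_vac : ∀ u : V, ncoeff (Y u) (-1) vac = u
  /-- the Borcherds identity; both sums have only finitely many non-zero terms -/
  borcherds : ∀ (u v w : V) (l m n : ℤ),
    ∑ᶠ i : ℕ, ((Ring.choose m i : ℤ) : ℂ) •
        ncoeff (Y (ncoeff (Y u) (l + i) v)) (m + n - i) w =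
      ∑ᶠ i : ℕ, ((-1 : ℂ) ^ i * ((Ring.choose l i : ℤ) : ℂ)) •
        (ncoeff (Y u) (m + l - i) (ncoeff (Y v) (n + i) w) -
          (-1 : ℂ) ^ l • ncoeff (Y v) (n + l - i) (ncoeff (Y u) (m + i) w))

namespace VertexAlgebra

variable {V : Type*} [AddCommGroup V] [Module ℂ V] (A : VertexAlgebra V)

/-- The mode `v₍ₙ₎`, i.e. the coefficient of `z ^ (-n-1)` in `Y(v, z)`. -/
def mode (v : V) (n : ℤ) : Module.End ℂ V := ncoeff (A.Y v) n

/-- The operators `Lₙ = x₍ₙ₊₁₎` satisfy the Virasoro relations with central charge `e`;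
equivalently, `x` generates a Virasoro vertex operator algebra of central charge `e`. -/
def IsVirasoro (x : V) (e : ℂ) : Prop :=
  ∀ m n : ℤ,
    A.mode x (m + 1) * A.mode x (n + 1) - A.mode x (n + 1) * A.mode x (m + 1) =
      ((m : ℂ) - n) • A.mode x (m + n + 1) +
        if m + n = 0 then ((((m : ℂ) ^ 3 - m) / 12) * e) • (1 : Module.End ℂ V) else 0

/-- Vertex subalgebras: subspaces containing the vacuum and closed under all products `u₍ₙ₎ v`. -/
def IsSubalgebra (U : Submodule ℂ V) : Prop :=
  A.vac ∈ U ∧ ∀ u ∈ U, ∀ v ∈ U, ∀ n : ℤ, A.mode u n v ∈ U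

/-- The vertex subalgebra generated by a vector `x`. -/
def generated (x : V) : Submodule ℂ V :=
  sInf {U : Submodule ℂ V | A.IsSubalgebra U ∧ x ∈ U}

/-- Two subalgebras commute: all modes of their elements commute as operators on `V`. -/
def Commuting (U W : Submodule ℂ V) : Prop :=
  ∀ u ∈ U, ∀ w ∈ W, ∀ m n : ℤ, A.mode u m * A.mode w n = A.mode w n * A.mode u m

/-- A subalgebra `U` is simple: it is irreducible as a module over itself. -/
def IsSimpleSubalgebra (U : Submodule ℂ V) : Prop :=
  U ≠ ⊥ ∧ ∀ I : Submodule ℂ V, I ≤ U →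
    (∀ u ∈ U, ∀ x ∈ I, ∀ n : ℤ, A.mode u n x ∈ I) → I = ⊥ ∨ I = U

end VertexAlgebra

/-- Vertex operator algebras of central charge `c` with `Vₙ = 0` for `n < 0` and `V₀ = ℂ 1`. -/
structure VertexOperatorAlgebra (c : ℂ) (V : Type*) [AddCommGroup V] [Module ℂ V] extends
    VertexAlgebra V where
  /-- the Virasoro vector `ω` -/
  conf : V
  conf_ne_zero : conf ≠ 0
  virasoro : toVertexAlgebra.IsVirasoro conf c
  /-- `(L₋₁ v)₍ₙ₎ = - n v₍ₙ₋₁₎`, i.e. `Y(L₋₁ v, z) = d/dz Y(v, z)` -/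
  derivative : ∀ (v : V) (n : ℤ), toVertexAlgebra.mode (toVertexAlgebra.mode conf 0 v) n =
    (-(n : ℂ)) • toVertexAlgebra.mode v (n - 1)
  /-- `V` is the direct sum of the eigenspaces of `L₀ = ω₍₁₎` with integral eigenvalues -/
  grading : DirectSum.IsInternal
    fun n : ℤ => Module.End.eigenspace (toVertexAlgebra.mode conf 1) (n : ℂ)
  finite : ∀ n : ℤ,
    FiniteDimensional ℂ (Module.End.eigenspace (toVertexAlgebra.mode conf 1) (n : ℂ))
  neg : ∀ n : ℤ, n < 0 → Module.End.eigenspace (toVertexAlgebra.mode conf 1) (n : ℂ) = ⊥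
  zero : Module.End.eigenspace (toVertexAlgebra.mode conf 1) (0 : ℂ) =
    Submodule.span ℂ {toVertexAlgebra.vac}

namespace VertexOperatorAlgebra

variable {c : ℂ} {V : Type*} [AddCommGroup V] [Module ℂ V] (A : VertexOperatorAlgebra c V)

/-- The Virasoro operator `Lₙ = ω₍ₙ₊₁₎`. -/
def L (n : ℤ) : Module.End ℂ V := A.mode A.conf (n + 1)

/-- The homogeneous subspace `Vₙ`, the eigenspace of `L₀` with eigenvalue `n`. -/
def grade (n : ℤ) : Submodule ℂ V := Module.End.eigenspace (A.L 0) (n : ℂ)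

theorem mem_grade {n : ℤ} {x : V} : x ∈ A.grade n ↔ A.L 0 x = (n : ℂ) • x :=
  Module.End.mem_eigenspace_iff

/-- The commutator formula `[L₀, v₍ₘ₎] = (L₋₁ v)₍ₘ₊₁₎ + (L₀ v)₍ₘ₎`. -/
theorem L_zero_mode (v w : V) (m : ℤ) :
    A.L 0 (A.mode v m w) =
      A.mode (A.mode A.conf 0 v) (m + 1) w + A.mode (A.L 0 v) m w + A.mode v m (A.L 0 w) := by
  have h := A.borcherds A.conf v w 0 1 m
  rw [finsum_eq_sum_of_support_subset (s := Finset.range 2),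
    finsum_eq_sum_of_support_subset (s := Finset.range 1)] at h
  · simp [Finset.sum_range_succ] at h
    simp only [L, VertexAlgebra.mode]
    rw [zero_add, ← sub_eq_iff_eq_add, ← h, add_comm 1 m]
  · intro i hi
    by_contra h'
    apply hi
    have : i ≠ 0 := by simpa using h'
    simp [Ring.choose_zero_pos ℤ (Nat.pos_of_ne_zero this)]
  · intro i hi
    by_contra h'
    apply hi
    have h2 : 1 < i := by simpa using h'
    have : Ring.choose (1 : ℤ) i = 0 := by
      have := Ring.choose_natCast (R := ℤ) 1 i
      rw [Nat.choose_eq_zero_of_lt h2] at this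
      simpa using this
    simp [this]

/-- For `v ∈ Vₙ` the operator `o(v) = v₍ₙ₋₁₎` is homogeneous of degree `0`. -/
theorem zeroMode_mem {n k : ℤ} {v w : V} (hv : v ∈ A.grade n) (hw : w ∈ A.grade k) :
    A.mode v (n - 1) w ∈ A.grade k := by
  rw [mem_grade] at *
  rw [L_zero_mode, A.derivative, hv, hw]
  simp only [VertexAlgebra.mode, map_smul, Pi.smul_apply, LinearMap.smul_apply]
  simp

/-- The operator `o(v) = v₍ₙ₋₁₎`, for `v ∈ Vₙ`, restricted to `V_k`. -/
def zeroMode (n k : ℤ) (v : A.grade n) : Module.End ℂ (A.grade k) :=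
  (A.mode (v : V) (n - 1)).restrict fun _ hw => A.zeroMode_mem v.2 hw

/-- Virasoro highest weight vectors of weight `h`. -/
def IsHighestWeight (h : ℂ) (x : V) : Prop :=
  A.L 0 x = h • x ∧ ∀ n : ℤ, 1 ≤ n → A.L n x = 0

/-- The Virasoro submodule of `V` generated by a vector. -/
def virasoroSpan (x : V) : Submodule ℂ V :=
  sInf {W : Submodule ℂ V | x ∈ W ∧ ∀ n : ℤ, ∀ y ∈ W, A.L n y ∈ W}

/-- A decomposition `V = ⨁ Mᵢ` into highest weight modules for the Virasoro algebra, i.e. into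
quotients of Verma modules `M(c, h)`, with `h` a non-negative integer. -/
structure HighestWeightDecomposition (ι : Type*) where
  /-- the highest weight of `Mᵢ` -/
  weight : ι → ℕ
  /-- a highest weight vector generating `Mᵢ` -/
  vec : ι → V
  vec_ne_zero : ∀ i, vec i ≠ 0
  isHighestWeight : ∀ i, A.IsHighestWeight (weight i) (vec i)
  indep : iSupIndep fun i => A.virasoroSpan (vec i)
  iSup_eq_top : ⨆ i, A.virasoroSpan (vec i) = ⊤

theorem L_mem_virasoroSpan {x y : V} (hy : y ∈ A.virasoroSpan x) (n : ℤ) :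
    A.L n y ∈ A.virasoroSpan x := by
  rw [virasoroSpan, Submodule.mem_sInf] at *
  exact fun W hW => hW.2 n y (hy W hW)

namespace HighestWeightDecomposition

variable {A} {ι : Type*} (D : A.HighestWeightDecomposition ι)

/-- The sum `M̄(h)` of all the `Mᵢ` of highest weight `h`. -/
def isotypic (h : ℕ) : Submodule ℂ V :=
  ⨆ i ∈ {i | D.weight i = h}, A.virasoroSpan (D.vec i)

theorem L_mem_isotypic {h : ℕ} {x : V} (hx : x ∈ D.isotypic h) (n : ℤ) :
    A.L n x ∈ D.isotypic h := by
  suffices D.isotypic h ≤ (D.isotypic h).comap (A.L n) from this hx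
  refine iSup₂_le fun i hi y hy => ?_
  exact Submodule.mem_iSup_of_mem i (Submodule.mem_iSup_of_mem hi (A.L_mem_virasoroSpan hy n))

/-- The complement `⨁_{h > 0} M̄(h)` of `M̄(0)`. -/
def positivePart : Submodule ℂ V := ⨆ h ∈ {h : ℕ | 0 < h}, D.isotypic h

theorem L_mem_positivePart {x : V} (hx : x ∈ D.positivePart) (n : ℤ) :
    A.L n x ∈ D.positivePart := by
  suffices D.positivePart ≤ D.positivePart.comap (A.L n) from this hx
  refine iSup₂_le fun i hi y hy => ?_
  exact Submodule.mem_iSup_of_mem i (Submodule.mem_iSup_of_mem hi (D.L_mem_isotypic hy n))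

theorem isCompl : IsCompl (D.isotypic 0) D.positivePart := by
  have hp : D.positivePart = ⨆ i ∈ {i | 0 < D.weight i}, A.virasoroSpan (D.vec i) := by
    apply le_antisymm
    · refine iSup₂_le fun h hh => iSup₂_le fun i hi => ?_
      have hi' : D.weight i = h := hi
      exact le_iSup₂_of_le i (show 0 < D.weight i by rw [hi']; exact hh) le_rfl
    · refine iSup₂_le fun i hi => ?_
      exact le_iSup₂_of_le (D.weight i) hi (le_iSup₂_of_le i rfl le_rfl)
  rw [hp]
  constructor
  · refine D.indep.disjoint_biSup_biSup ?_
    rw [Set.disjoint_left]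
    intro i (hi : D.weight i = 0) (hi' : 0 < D.weight i)
    omega
  · rw [codisjoint_iff, eq_top_iff, ← D.iSup_eq_top]
    refine iSup_le fun i => ?_
    rcases Nat.eq_zero_or_pos (D.weight i) with hi | hi
    · exact le_sup_of_le_left (le_iSup₂_of_le i hi le_rfl)
    · exact le_sup_of_le_right (le_iSup₂_of_le i hi le_rfl)

/-- The natural projection `π : V → V_ω = M̄(0)` with kernel `⨁_{h > 0} M̄(h)`. -/
def proj : V →ₗ[ℂ] V := Submodule.projection _ _ D.isCompl

theorem proj_mem_grade {n : ℤ} {v : V} (hv : v ∈ A.grade n) : D.proj v ∈ A.grade n := by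
  rw [mem_grade] at *
  have hsplit : D.proj v + Submodule.projection _ _ D.isCompl.symm v = v :=
    Submodule.projection_add_projection_eq_self D.isCompl v
  set p := D.proj v with hp
  set q := Submodule.projection _ _ D.isCompl.symm v with hq
  have hpm : p ∈ D.isotypic 0 := Submodule.projection_apply_mem D.isCompl v
  have hqm : q ∈ D.positivePart := Submodule.projection_apply_mem D.isCompl.symm v
  have h1 : A.L 0 p - (n : ℂ) • p ∈ D.isotypic 0 :=
    sub_mem (D.L_mem_isotypic hpm 0) (Submodule.smul_mem _ _ hpm)
  have h2 : A.L 0 p - (n : ℂ) • p ∈ D.positivePart := by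
    have : A.L 0 p - (n : ℂ) • p = -(A.L 0 q - (n : ℂ) • q) := by
      rw [← hsplit, map_add, smul_add] at hv
      rw [neg_sub, sub_eq_sub_iff_add_eq_add, hv, add_comm]
    rw [this]
    exact neg_mem (sub_mem (D.L_mem_positivePart hqm 0) (Submodule.smul_mem _ _ hqm))
  exact sub_eq_zero.1 (Submodule.disjoint_def.1 D.isCompl.disjoint _ h1 h2)

/-- The degree `k` subspace `V_k` is a conformal `t`-design:
`tr|_{V_k} o(v) = tr|_{V_k} o(π(v))` for all `v ∈ Vₙ` with `0 ≤ n ≤ t`. -/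
def IsConformalDesign (t : ℕ) (k : ℤ) : Prop :=
  ∀ n : ℕ, n ≤ t → ∀ v : A.grade n,
    LinearMap.trace ℂ (A.grade k) (A.zeroMode n k v) =
      LinearMap.trace ℂ (A.grade k) (A.zeroMode n k ⟨D.proj v, D.proj_mem_grade v.2⟩)

end HighestWeightDecomposition

end VertexOperatorAlgebra

end

noncomputable section

open VertexOperator

/-! Write `a = ω'`, `b = ω - ω'`, with central charges `e`, `f`, and `d = dim V_2`. The vectors
`a₍₋₁₎b ∈ V_4` and `a₍₋₂₎b₍₋₂₎1 ∈ V_6` have closely related zero modes on `V_2`: the second acts as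
`4 o(b)o(a)`, the first as `o(b)o(a)` plus two rank-one maps of trace zero. So one trace is four
times the other (`zeroModeTrace_six_eq_four_mul`).

The design property allows both vectors to be replaced by their projections to `M̄(0)`, which are
combinations of two, respectively four, Virasoro words applied to the vacuum. On `V_2` each word
acts as a scalar plus a multiple of `L₋₂L₂`, whose trace is `c/2`; hence both traces are affine in
`d`. Since `π` commutes with every `Lₙ` and fixes `1`, the coordinates of the projections satisfy
linear systems whose matrices are the Gram matrices at levels 4 and 6 and whose right-hand sides are
multiples of `ef`.

Eliminating the coordinates (`dimension_formula_of_gram`) leaves `ef` times a linear equation for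
`d` with leading coefficient `2(748 - 55c + c²)`. Both factors are nonzero, so `d` is determined. -/

theorem Ring.choose_neg_natCast_succ (j i : ℕ) :
    Ring.choose (-(j : ℤ) - 1) i = (-1) ^ i * ((i + j).choose j : ℤ) := by
  have h : (-(j : ℤ) - 1) = -((j + 1 : ℕ) : ℤ) := by push_cast; ring
  rw [h, Ring.choose_neg]
  have h2 : (((j + 1 : ℕ) : ℤ) + i - 1) = ((i + j : ℕ) : ℤ) := by push_cast; ring
  rw [h2, Ring.choose_natCast, Nat.choose_symm_add]
  simp [Int.negOnePow_def, Units.smul_def]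

/-! ### Commutator and iterate formulas from the Borcherds identity. -/

namespace VertexAlgebra

variable {V : Type*} [AddCommGroup V] [Module ℂ V] (A : VertexAlgebra V)

theorem mode_add (u v : V) (n : ℤ) : A.mode (u + v) n = A.mode u n + A.mode v n := by
  simp [mode]

theorem mode_smul (r : ℂ) (v : V) (n : ℤ) : A.mode (r • v) n = r • A.mode v n := by
  simp [mode]

/-- The commutator formula for a mode `u₍₀₎`. -/
theorem mode_zero_mode (u v w : V) (n : ℤ) :
    A.mode u 0 (A.mode v n w) = A.mode (A.mode u 0 v) n w + A.mode v n (A.mode u 0 w) := by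
  have h := A.borcherds u v w 0 0 n
  rw [finsum_eq_single _ 0, finsum_eq_single _ 0] at h
  · simp at h
    simp only [mode]
    rw [h]
    abel
  · intro i hi
    simp [Ring.choose_zero_pos ℤ (Nat.pos_of_ne_zero hi)]
  · intro i hi
    simp [Ring.choose_zero_pos ℤ (Nat.pos_of_ne_zero hi)]

/-- The iterate formula for `u₍₋ⱼ₋₁₎ v`, where the sum may be cut off after `N` terms. -/
theorem mode_mode_neg (u v w : V) (j : ℕ) (n : ℤ) (N : ℕ)
    (h1 : ∀ i : ℕ, N ≤ i → A.mode v (n + i) w = 0)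
    (h2 : ∀ i : ℕ, N ≤ i → A.mode u i w = 0) :
    A.mode (A.mode u (-(j : ℤ) - 1) v) n w = ∑ i ∈ Finset.range N,
      ((i + j).choose j : ℂ) • (A.mode u (-(j : ℤ) - 1 - i) (A.mode v (n + i) w) +
        (-1 : ℂ) ^ j • A.mode v (n - j - 1 - i) (A.mode u i w)) := by
  -- Taking the middle index to be `0` reduces the left-hand sum to its term `i = 0`, the mode of
  -- `u₍₋ⱼ₋₁₎v`.
  have h := A.borcherds u v w (-(j : ℤ) - 1) 0 n
  rw [finsum_eq_single _ 0, finsum_eq_sum_of_support_subset (s := Finset.range N)] at h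
  · simp only [Ring.choose_zero_right, Nat.cast_zero, Int.cast_one, one_smul, add_zero, zero_add,
      sub_zero] at h
    simp only [mode]
    rw [h]
    refine Finset.sum_congr rfl fun i _ => ?_
    rw [Ring.choose_neg_natCast_succ]
    have e1 : (-1 : ℂ) ^ i * (((-1) ^ i * ((i + j).choose j : ℤ) : ℤ) : ℂ) =
        ((i + j).choose j : ℂ) := by
      push_cast
      rw [← mul_assoc, ← mul_pow]
      simp
    have e2 : (-1 : ℂ) ^ (-(j : ℤ) - 1) = -(-1) ^ j := by
      rw [zpow_sub₀ (by norm_num), zpow_neg, zpow_natCast, ← inv_pow]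
      norm_num [div_neg]
    rw [e1, e2, neg_smul, sub_neg_eq_add, ← add_sub_assoc n, ← sub_eq_add_neg]
  · intro i hi
    by_contra h'
    apply hi
    have hN : N ≤ i := by simpa using h'
    have a1 := h1 i hN
    have a2 := h2 i hN
    simp only [mode] at a1 a2
    simp [a1, a2]
  · intro i hi
    simp [Ring.choose_zero_pos ℤ (Nat.pos_of_ne_zero hi)]

end VertexAlgebra

/-! ### Weights, Virasoro relations and traces of zero modes. -/

namespace VertexOperatorAlgebra

variable {c : ℂ} {V : Type*} [AddCommGroup V] [Module ℂ V] (A : VertexOperatorAlgebra c V)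

theorem mode_mem_grade {m k l n : ℤ} {v w : V} (hv : v ∈ A.grade m) (hw : w ∈ A.grade k)
    (hl : l = k + m - n - 1) : A.mode v n w ∈ A.grade l := by
  subst hl
  rw [mem_grade] at *
  rw [L_zero_mode, A.derivative, hv, hw]
  simp only [VertexAlgebra.mode, map_smul, Pi.smul_apply, LinearMap.smul_apply]
  rw [add_sub_cancel_right, ← add_smul, ← add_smul]
  push_cast
  congr 1
  ring

theorem eq_zero_of_mem_grade_neg {k : ℤ} (hk : k < 0) {w : V} (hw : w ∈ A.grade k) : w = 0 := by
  have h : A.grade k = ⊥ := A.neg k hk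
  simpa [h] using hw

theorem grade_zero : A.grade 0 = Submodule.span ℂ {A.vac} := by
  have h := A.zero
  rw [← h]
  simp only [grade, Int.cast_zero]
  rfl

theorem vac_mem_grade : A.vac ∈ A.grade 0 := by
  rw [grade_zero]
  exact Submodule.mem_span_singleton_self _

theorem L_vac {n : ℤ} (hn : -1 ≤ n) : A.L n A.vac = 0 :=
  A.mode_vac _ _ (by omega)

theorem L_neg_two_vac : A.L (-2) A.vac = A.conf := A.mode_neg_one_vac _

theorem L_L (m n : ℤ) (x : V) :
    A.L m (A.L n x) = A.L n (A.L m x) + ((m : ℂ) - n) • A.L (m + n) x +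
      if m + n = 0 then ((((m : ℂ) ^ 3 - m) / 12) * c) • x else 0 := by
  have h := congrArg (fun f : Module.End ℂ V => f x) (A.virasoro m n)
  simp only [LinearMap.sub_apply, Module.End.mul_apply, LinearMap.add_apply, LinearMap.smul_apply,
    sub_eq_iff_eq_add] at h
  simp only [L]
  rw [h]
  split_ifs with h0
  · simp
    abel
  · simp
    abel

/-- The inequalities orient the commutation relation for `simp`: modes that annihilate the vacuum
move right past creation modes, and never back. -/
theorem L_L_of_le {m n : ℤ} (_hm : -1 ≤ m) (_hn : n ≤ -2) (x : V) :
    A.L m (A.L n x) = A.L n (A.L m x) + ((m : ℂ) - n) • A.L (m + n) x +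
      if m + n = 0 then ((((m : ℂ) ^ 3 - m) / 12) * c) • x else 0 :=
  A.L_L m n x

theorem conf_mem_grade : A.conf ∈ A.grade 2 := by
  rw [mem_grade, ← L_neg_two_vac, A.L_L]
  simp [A.L_vac]

theorem L_mem_grade {n k l : ℤ} {w : V} (hw : w ∈ A.grade k) (hl : l = k - n) :
    A.L n w ∈ A.grade l :=
  A.mode_mem_grade A.conf_mem_grade hw (by omega)

/-- The linear functional `v ↦ tr|_{V_k} o(v)` on `Vₙ`. -/
def zeroModeTrace (n k : ℤ) : A.grade n →ₗ[ℂ] ℂ where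
  toFun v := LinearMap.trace ℂ (A.grade k) (A.zeroMode n k v)
  map_add' u v := by
    rw [← map_add]
    congr 1
    ext w
    simp [zeroMode, A.mode_add]
  map_smul' r v := by
    rw [RingHom.id_apply, ← map_smul]
    congr 1
    ext w
    simp [zeroMode, A.mode_smul]

/-- The functional `⟨a, ·⟩` on `V_k` with `a₍ₖ₊₁₎ w = ⟨a, w⟩ 1` for `a ∈ V_2`. -/
theorem exists_functional {a : V} (ha : a ∈ A.grade 2) (k : ℤ) :
    ∃ f : A.grade k →ₗ[ℂ] ℂ, ∀ w : A.grade k, A.mode a (k + 1) w = f w • A.vac := by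
  have h : ∀ w ∈ A.grade k, A.mode a (k + 1) w ∈ Submodule.span ℂ {A.vac} := fun w hw => by
    rw [← grade_zero]
    exact A.mode_mem_grade ha hw (by ring)
  refine ⟨(LinearEquiv.toSpanNonzeroSingleton ℂ V A.vac A.vac_ne_zero).symm.toLinearMap ∘ₗ
    (A.mode a (k + 1)).restrict h, fun w => ?_⟩
  have h1 := (LinearEquiv.toSpanNonzeroSingleton ℂ V A.vac A.vac_ne_zero).apply_symm_apply
    ((A.mode a (k + 1)).restrict h w)
  have h2 := congrArg Subtype.val h1
  simp

variable {A}

theorem zeroModeTrace_eq {n : ℤ} (v : A.grade n) (r : ℂ) (f : A.grade 2 →ₗ[ℂ] ℂ)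
    (b : A.grade 2)
    (h : ∀ w : A.grade 2, A.mode (v : V) (n - 1) w = r • (w : V) + f w • (b : V)) :
    A.zeroModeTrace n 2 v = r * Module.finrank ℂ (A.grade 2) + f b := by
  have hz : A.zeroMode n 2 v = r • LinearMap.id + f.smulRight b := by
    ext w
    simpa [zeroMode] using h w
  have : FiniteDimensional ℂ (A.grade 2) := A.finite 2
  change LinearMap.trace ℂ (A.grade 2) (A.zeroMode n 2 v) = _
  rw [hz, map_add, map_smul, LinearMap.trace_id, LinearMap.trace_smulRight, smul_eq_mul]

/-- The action of `o(a₍₋ⱼ₋₁₎ v)` on `V_2` for `a ∈ V_2`, when `V_1 = 0`. -/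
theorem mode_iterate_apply (hV1 : A.grade 1 = ⊥) {a v w : V} {m : ℤ} (j : ℕ)
    (ha : a ∈ A.grade 2) (hv : v ∈ A.grade m) (hw : w ∈ A.grade 2) :
    A.mode (A.mode a (-(j : ℤ) - 1) v) (m + j + 1) w =
      (if j = 0 then A.mode a (-1) (A.mode v (m + 1) w) else 0) +
      (-1 : ℂ) ^ j • (A.mode v m (A.mode a 0 w) + ((j : ℂ) + 1) • A.mode v (m - 1) (A.mode a 1 w) +
        ((j + 3).choose j : ℂ) • A.mode v (m - 3) (A.mode a 3 w)) := by
  -- This vector has weight `-j - i`, so it survives only for `i = j = 0`. Likewise `a₍ᵢ₎w` has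
  -- weight `3 - i`: the sum stops before `i = 4`, and `V_1 = 0` removes `i = 2`.
  have z1 : ∀ i : ℕ, j + i ≠ 0 → A.mode v (m + j + 1 + i) w = 0 := fun i hi =>
    A.eq_zero_of_mem_grade_neg (k := -j - i) (by omega) (A.mode_mem_grade hv hw (by ring))
  have z2 : ∀ i : ℕ, 4 ≤ i → A.mode a i w = 0 := fun i hi =>
    A.eq_zero_of_mem_grade_neg (k := 3 - i) (by omega) (A.mode_mem_grade ha hw (by ring))
  have z3 : A.mode a 2 w = 0 := by
    have : A.mode a 2 w ∈ A.grade 1 := A.mode_mem_grade ha hw (by ring)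
    simpa [hV1] using this
  rw [A.mode_mode_neg a v w j _ 4 (fun i hi => z1 i (by omega)) z2]
  simp only [Finset.sum_range_succ, Finset.sum_range_zero]
  rw [z1 1 (by omega), z1 2 (by omega), z1 3 (by omega)]
  have e0 : m + j + 1 - j - 1 - ((0 : ℕ) : ℤ) = m := by push_cast; ring
  have e1 : m + j + 1 - j - 1 - ((1 : ℕ) : ℤ) = m - 1 := by push_cast; ring
  have e3 : m + j + 1 - j - 1 - ((3 : ℕ) : ℤ) = m - 3 := by push_cast; ring
  rw [e0, e1, e3]
  have c1 : (1 + j).choose j = j + 1 := by rw [add_comm, Nat.choose_succ_self_right]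
  rw [c1, add_comm 3 j]
  simp only [Nat.cast_ofNat, Nat.cast_one, Nat.cast_zero, z3, map_zero, smul_zero, add_zero,
    zero_add, sub_zero, Nat.choose_self, one_smul, smul_add, Nat.cast_add]
  rcases Nat.eq_zero_or_pos j with rfl | hj
  · simp only [if_true, Nat.cast_zero]
    simp [add_assoc]
  · have := z1 0 (by omega)
    rw [Nat.cast_zero, add_zero] at this
    rw [this, if_neg (by omega), map_zero]
    module

theorem L_one_apply (hV1 : A.grade 1 = ⊥) {w : V} (hw : w ∈ A.grade 2) : A.L 1 w = 0 := by
  have : A.L 1 w ∈ A.grade 1 := A.L_mem_grade hw (by ring)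
  simpa [hV1] using this

theorem L_zero_apply {w : V} (hw : w ∈ A.grade 2) : A.L 0 w = (2 : ℂ) • w := by
  simpa using A.mem_grade.1 hw

theorem L_apply_eq_zero {n : ℤ} (hn : 2 < n) {w : V} (hw : w ∈ A.grade 2) : A.L n w = 0 :=
  A.eq_zero_of_mem_grade_neg (by omega) (A.L_mem_grade hw rfl)

/-- `mode_iterate_apply` for the Virasoro vector. -/
theorem mode_L_neg_apply (hV1 : A.grade 1 = ⊥) {v w : V} {m : ℤ} (j : ℕ)
    (hv : v ∈ A.grade m) (hw : w ∈ A.grade 2) :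
    A.mode (A.L (-(j : ℤ) - 2) v) (m + j + 1) w =
      (if j = 0 then A.L (-2) (A.mode v (m + 1) w) else 0) +
      (-1 : ℂ) ^ j • ((m + 2 * (j + 1) : ℂ) • A.mode v (m - 1) w +
        ((j + 3).choose j : ℂ) • A.mode v (m - 3) (A.L 2 w)) := by
  -- As `v₍ₘ₎w ∈ V_1 = 0`, commuting `L₋₁` past `v₍ₘ₎` leaves only `-(L₋₁v)₍ₘ₎w = m v₍ₘ₋₁₎w`.
  have h0 : A.mode v m (A.mode A.conf 0 w) = (m : ℂ) • A.mode v (m - 1) w := by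
    have hz : A.mode v m w = 0 := by
      have : A.mode v m w ∈ A.grade 1 := A.mode_mem_grade hv hw (by ring)
      simpa [hV1] using this
    have h := A.mode_zero_mode A.conf v w m
    rw [hz, map_zero, A.derivative, LinearMap.smul_apply] at h
    rw [neg_smul, eq_comm] at h
    exact (neg_add_eq_zero.1 h).symm
  have h1 : A.mode A.conf 1 w = (2 : ℂ) • w := L_zero_apply hw
  have h := mode_iterate_apply hV1 j A.conf_mem_grade hv hw
  rw [h0, h1, map_smul] at h
  have e : A.L (-(j : ℤ) - 2) = A.mode A.conf (-(j : ℤ) - 1) := by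
    rw [L]; congr 1; ring
  rw [e, h]
  have e2 : A.L (-2) = A.mode A.conf (-1) := rfl
  have e3 : A.L 2 = A.mode A.conf 3 := rfl
  rw [e2, e3]
  module

/-! ### Zero modes of Virasoro words of weight 4 and 6 on `V_2`. -/

theorem mode_vac_apply (n : ℤ) (w : V) : A.mode A.vac n w = if n = -1 then w else 0 := by
  rw [VertexAlgebra.mode, A.vac_mode]
  split_ifs <;> rfl

theorem mode_L_neg_four_vac_apply (hV1 : A.grade 1 = ⊥) {w : V} (hw : w ∈ A.grade 2) :
    A.mode (A.L (-4) A.vac) 3 w = (6 : ℂ) • w := by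
  have h := mode_L_neg_apply hV1 2 A.vac_mem_grade hw
  norm_num [mode_vac_apply] at h
  exact h

theorem mode_L_neg_six_vac_apply (hV1 : A.grade 1 = ⊥) {w : V} (hw : w ∈ A.grade 2) :
    A.mode (A.L (-6) A.vac) 5 w = (10 : ℂ) • w := by
  have h := mode_L_neg_apply hV1 4 A.vac_mem_grade hw
  norm_num [mode_vac_apply] at h
  exact h

theorem mode_L_neg_three_vac (n : ℤ) :
    A.mode (A.L (-3) A.vac) n = (-(n : ℂ)) • A.mode A.conf (n - 1) := by
  rw [← A.derivative]
  congr 1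
  have h := A.L_L (-1) (-2) A.vac
  rw [A.L_vac le_rfl, A.L_neg_two_vac] at h
  norm_num at h
  exact h.symm

theorem mode_L_neg_two_L_neg_two_vac_apply (hV1 : A.grade 1 = ⊥) {w : V} (hw : w ∈ A.grade 2) :
    A.mode (A.L (-2) (A.L (-2) A.vac)) 3 w = (8 : ℂ) • w + (2 : ℂ) • A.L (-2) (A.L 2 w) := by
  have h := mode_L_neg_apply hV1 0 A.conf_mem_grade hw
  rw [L_neg_two_vac]
  have e1 : A.mode A.conf 3 = A.L 2 := rfl
  have e2 : A.mode A.conf (-1) = A.L (-2) := rfl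
  have e3 : A.mode A.conf 1 = A.L 0 := rfl
  norm_num [e1, e2, e3, L_zero_apply hw] at h
  rw [h]
  module

theorem mode_L_neg_four_L_neg_two_vac_apply (hV1 : A.grade 1 = ⊥) {w : V} (hw : w ∈ A.grade 2) :
    A.mode (A.L (-4) (A.L (-2) A.vac)) 5 w = (16 : ℂ) • w + (10 : ℂ) • A.L (-2) (A.L 2 w) := by
  have h := mode_L_neg_apply hV1 2 A.conf_mem_grade hw
  rw [L_neg_two_vac]
  have e2 : A.mode A.conf (-1) = A.L (-2) := rfl
  have e3 : A.mode A.conf 1 = A.L 0 := rfl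
  norm_num [e2, e3, L_zero_apply hw, Nat.choose] at h
  rw [h]
  module

theorem L_neg_three_vac_mem_grade : A.L (-3) A.vac ∈ A.grade 3 :=
  A.L_mem_grade A.vac_mem_grade (by norm_num)

theorem mode_L_neg_three_L_neg_three_vac_apply (hV1 : A.grade 1 = ⊥) {w : V}
    (hw : w ∈ A.grade 2) : A.mode (A.L (-3) (A.L (-3) A.vac)) 5 w = (28 : ℂ) • w := by
  have h := mode_L_neg_apply hV1 1 A.L_neg_three_vac_mem_grade hw
  have e3 : A.mode A.conf 1 = A.L 0 := rfl
  norm_num [e3, L_zero_apply hw, mode_L_neg_three_vac] at h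
  rw [h]
  module

/-- Not a zero mode: it lowers `V_2` to `V_0`, and is the inner term `v₍ₘ₊₁₎w` in the iterate
formula for `L₋₂³1`. -/
theorem mode_L_neg_two_L_neg_two_vac_five_apply (hV1 : A.grade 1 = ⊥) {w : V}
    (hw : w ∈ A.grade 2) : A.mode (A.L (-2) (A.L (-2) A.vac)) 5 w = (6 : ℂ) • A.L 2 w := by
  have z : ∀ i : ℕ, 4 ≤ i → A.mode A.conf i w = 0 := fun i hi =>
    A.eq_zero_of_mem_grade_neg (k := 3 - i) (by omega)
      (A.mode_mem_grade A.conf_mem_grade hw (by ring))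
  have h := A.mode_mode_neg A.conf A.conf w 0 5 4
    (fun i hi => by have := z (5 + i) (by omega); exact_mod_cast this) z
  have e : ∀ n : ℤ, A.mode A.conf n = A.L (n - 1) := fun n => by rw [L]; congr 1; ring
  have hL2 : A.L 2 w ∈ A.grade 0 := A.L_mem_grade hw (by norm_num)
  have hL02 : A.L 0 (A.L 2 w) = 0 := by simpa using A.mem_grade.1 hL2
  have hL3 : A.L 3 (A.L (-1) w) = (4 : ℂ) • A.L 2 w := by
    rw [A.L_L, L_apply_eq_zero (by norm_num) hw]
    norm_num
  rw [L_neg_two_vac]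
  simp only [Finset.sum_range_succ, Finset.sum_range_zero] at h
  norm_num [e, L_apply_eq_zero _ hw, hL3, hL02, L_zero_apply hw, L_one_apply hV1 hw] at h
  rw [h]
  module

theorem mode_L_neg_two_cube_vac_apply (hV1 : A.grade 1 = ⊥) {w : V} (hw : w ∈ A.grade 2) :
    A.mode (A.L (-2) (A.L (-2) (A.L (-2) A.vac))) 5 w =
      (48 : ℂ) • w + (18 : ℂ) • A.L (-2) (A.L 2 w) := by
  have hX : A.L (-2) (A.L (-2) A.vac) ∈ A.grade 4 :=
    A.L_mem_grade (A.L_mem_grade A.vac_mem_grade rfl) (by norm_num)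
  have h := mode_L_neg_apply hV1 0 hX hw
  have hz : A.mode (A.L (-2) (A.L (-2) A.vac)) 1 (A.L 2 w) = 0 := by
    have hL2 : A.L 2 w ∈ A.grade 0 := A.L_mem_grade hw (by norm_num)
    rw [grade_zero, Submodule.mem_span_singleton] at hL2
    obtain ⟨r, hr⟩ := hL2
    rw [← hr, map_smul]
    rw [show A.mode (A.L (-2) (A.L (-2) A.vac)) 1 A.vac = 0 from A.mode_vac _ _ (by norm_num),
      smul_zero]
  norm_num [hz, mode_L_neg_two_L_neg_two_vac_apply hV1 hw,
    mode_L_neg_two_L_neg_two_vac_five_apply hV1 hw] at h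
  rw [h]
  module

/-- Traces over `V_2` of zero modes acting by a scalar plus a multiple of `L₋₂ L₂`. -/
theorem zeroModeTrace_eq_of_L {n : ℤ} (v : A.grade n) (r s : ℂ)
    (h : ∀ w ∈ A.grade 2, A.mode (v : V) (n - 1) w = r • w + s • A.L (-2) (A.L 2 w)) :
    A.zeroModeTrace n 2 v = r * Module.finrank ℂ (A.grade 2) + s * (c / 2) := by
  -- `L₂` maps `V_2` to `ℂ1` and `L₋₂1 = ω`, so `L₋₂L₂` is the rank-one map `w ↦ f(w)ω`, with trace
  -- `f(ω) = c/2`.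
  obtain ⟨f, hf⟩ := A.exists_functional A.conf_mem_grade 2
  have hfL : ∀ w : A.grade 2, A.L 2 w = f w • A.vac := hf
  have hc : f ⟨A.conf, A.conf_mem_grade⟩ = c / 2 := by
    have h0 : A.L 2 A.conf = (c / 2) • A.vac := by
      rw [← L_neg_two_vac, A.L_L]
      norm_num [A.L_vac]
      congr 1
      ring
    have h1 := hfL ⟨A.conf, A.conf_mem_grade⟩
    exact smul_left_injective ℂ A.vac_ne_zero (h1.symm.trans h0)
  rw [zeroModeTrace_eq v r (s • f) ⟨A.conf, A.conf_mem_grade⟩, LinearMap.smul_apply, hc,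
    smul_eq_mul]
  intro w
  rw [h w w.2, hfL, map_smul, L_neg_two_vac, LinearMap.smul_apply, smul_assoc]

/-! ### Zero modes built from two commuting vectors of weight 2. -/

section CommutingPair

variable {a b : V}

/-- The remaining term `b₍₂₎a₍₀₎w` of the iterate formula equals `a₍₀₎b₍₂₎w`, and `b₍₂₎w ∈ V_1 = 0`.
The bracketed terms factor through `V_0`, so they have rank at most one. -/
theorem mode_neg_one_apply_of_commute (hcomm : ∀ m n : ℤ, A.mode a m * A.mode b n =
      A.mode b n * A.mode a m) (hV1 : A.grade 1 = ⊥) (ha : a ∈ A.grade 2) (hb : b ∈ A.grade 2)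
    {w : V} (hw : w ∈ A.grade 2) :
    A.mode (A.mode a (-1) b) 3 w = A.mode b 1 (A.mode a 1 w) +
      (A.mode a (-1) (A.mode b 3 w) + A.mode b (-1) (A.mode a 3 w)) := by
  have hab : ∀ (m n : ℤ) (x : V), A.mode a m (A.mode b n x) = A.mode b n (A.mode a m x) :=
    fun m n x => congrArg (fun f : Module.End ℂ V => f x) (hcomm m n)
  have hb2 : A.mode b 2 w = 0 := by
    have : A.mode b 2 w ∈ A.grade 1 := A.mode_mem_grade hb hw (by ring)
    simpa [hV1] using this
  have h := mode_iterate_apply hV1 0 ha hb hw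
  rw [← hab 0 2, hb2] at h
  norm_num at h
  rw [h]
  abel

/-- `b₍₋₂₎1 = L₋₁b`, so its modes come from the derivative axiom. -/
theorem mode_neg_two_vac (n : ℤ) (b : V) :
    A.mode (A.mode b (-2) A.vac) n = (-(n : ℂ)) • A.mode b (n - 1) := by
  rw [← A.derivative]
  congr 1
  have h := A.derivative b (-1)
  have h2 := congrArg (fun f : Module.End ℂ V => f A.vac) h
  simp only [VertexAlgebra.mode, A.mode_neg_one_vac] at h2
  norm_num at h2
  exact h2.symm

/-- No rank-one term appears here because `(L₋₁b)₍₀₎ = 0`. The constant is `(-1) · 2 · (-2)`, from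
the iterate formula and `(L₋₁b)₍₂₎ = -2 b₍₁₎`. -/
theorem mode_neg_two_apply_of_commute (hcomm : ∀ m n : ℤ, A.mode a m * A.mode b n =
      A.mode b n * A.mode a m) (hV1 : A.grade 1 = ⊥) (ha : a ∈ A.grade 2) (hb : b ∈ A.grade 2)
    {w : V} (hw : w ∈ A.grade 2) :
    A.mode (A.mode a (-2) (A.mode b (-2) A.vac)) 5 w =
      (4 : ℂ) • A.mode b 1 (A.mode a 1 w) := by
  have hab : ∀ (m n : ℤ) (x : V), A.mode a m (A.mode b n x) = A.mode b n (A.mode a m x) :=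
    fun m n x => congrArg (fun f : Module.End ℂ V => f x) (hcomm m n)
  have hb2 : A.mode b 2 w = 0 := by
    have : A.mode b 2 w ∈ A.grade 1 := A.mode_mem_grade hb hw (by ring)
    simpa [hV1] using this
  have hv : A.mode b (-2) A.vac ∈ A.grade 3 := A.mode_mem_grade hb A.vac_mem_grade (by norm_num)
  have h := mode_iterate_apply hV1 1 ha hv hw
  norm_num [mode_neg_two_vac, ← hab 0 2, hb2] at h
  rw [h]
  module

theorem mode_neg_one_mem_grade (ha : a ∈ A.grade 2) (hb : b ∈ A.grade 2) :
    A.mode a (-1) b ∈ A.grade 4 :=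
  A.mode_mem_grade ha hb (by norm_num)

theorem mode_neg_two_mem_grade (ha : a ∈ A.grade 2) (hb : b ∈ A.grade 2) :
    A.mode a (-2) (A.mode b (-2) A.vac) ∈ A.grade 6 :=
  A.mode_mem_grade ha (A.mode_mem_grade hb A.vac_mem_grade (by norm_num : (3 : ℤ) = _))
    (by norm_num)

/-- The trace relation between `a₍₋₂₎ b₍₋₂₎ 1` and `a₍₋₁₎ b` for commuting `a, b ∈ V_2`. -/
theorem zeroModeTrace_six_eq_four_mul (hcomm : ∀ m n : ℤ, A.mode a m * A.mode b n =
      A.mode b n * A.mode a m) (hV1 : A.grade 1 = ⊥) (ha : a ∈ A.grade 2) (hb : b ∈ A.grade 2) :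
    A.zeroModeTrace 6 2 ⟨_, mode_neg_two_mem_grade ha hb⟩ =
      4 * A.zeroModeTrace 4 2 ⟨_, mode_neg_one_mem_grade ha hb⟩ := by
  have hab : ∀ (m n : ℤ) (x : V), A.mode a m (A.mode b n x) = A.mode b n (A.mode a m x) :=
    fun m n x => congrArg (fun f : Module.End ℂ V => f x) (hcomm m n)
  have hfin : FiniteDimensional ℂ (A.grade 2) := A.finite 2
  obtain ⟨f, hf⟩ := A.exists_functional ha 2
  obtain ⟨g, hg⟩ := A.exists_functional hb 2
  -- The trace of the rank-one part is a pairing of `a` with `b`, which vanishes: `a₍₃₎b =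
  -- a₍₃₎b₍₋₁₎1 = b₍₋₁₎a₍₃₎1 = 0`.
  have hfb : f ⟨b, hb⟩ = 0 := by
    have h := hf ⟨b, hb⟩
    have h1 : A.mode a 3 b = 0 := by
      conv_lhs => rw [← A.mode_neg_one_vac b]
      have h2 := hab 3 (-1) A.vac
      rw [show A.mode a 3 A.vac = 0 from A.mode_vac _ _ (by norm_num), map_zero] at h2
      exact h2
    norm_num at h
    rw [h1] at h
    exact (smul_eq_zero_iff_left A.vac_ne_zero).1 h.symm
  have hga : g ⟨a, ha⟩ = 0 := by
    have h := hg ⟨a, ha⟩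
    have h1 : A.mode b 3 a = 0 := by
      conv_lhs => rw [← A.mode_neg_one_vac a]
      have h2 := hab (-1) 3 A.vac
      rw [show A.mode b 3 A.vac = 0 from A.mode_vac _ _ (by norm_num), map_zero] at h2
      exact h2.symm
    norm_num at h
    rw [h1] at h
    exact (smul_eq_zero_iff_left A.vac_ne_zero).1 h.symm
  have h4 : A.zeroMode 4 2 ⟨_, mode_neg_one_mem_grade ha hb⟩ =
      A.zeroMode 2 2 ⟨b, hb⟩ * A.zeroMode 2 2 ⟨a, ha⟩ +
        (g.smulRight ⟨a, ha⟩ + f.smulRight ⟨b, hb⟩) := by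
    ext w
    have h := mode_neg_one_apply_of_commute hcomm hV1 ha hb w.2
    have hf' := hf w
    have hg' := hg w
    norm_num at hf' hg'
    rw [hf', hg', map_smul, map_smul,
      show A.mode a (-1) A.vac = a from A.mode_neg_one_vac a,
      show A.mode b (-1) A.vac = b from A.mode_neg_one_vac b] at h
    exact h
  have h6 : A.zeroMode 6 2 ⟨_, mode_neg_two_mem_grade ha hb⟩ =
      (4 : ℂ) • (A.zeroMode 2 2 ⟨b, hb⟩ * A.zeroMode 2 2 ⟨a, ha⟩) := by
    ext w
    exact mode_neg_two_apply_of_commute hcomm hV1 ha hb w.2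
  change LinearMap.trace ℂ _ (A.zeroMode 6 2 _) = 4 * LinearMap.trace ℂ _ (A.zeroMode 4 2 _)
  rw [h4, h6, map_smul, map_add, map_add, LinearMap.trace_smulRight, LinearMap.trace_smulRight,
    hfb, hga, smul_eq_mul, add_zero, add_zero]

end CommutingPair

/-! ### Virasoro words spanning the vacuum module in each weight. -/

variable (A) in
/-- Words `L_{n₁} ⋯ L_{nₖ} 1` of weight `l` with all `nᵢ ≤ -2`. -/
inductive IsVirasoroWord : ℤ → V → Prop
  | vac : IsVirasoroWord 0 A.vac
  | L {l m n : ℤ} {x : V} (hn : n ≤ -2) (hx : IsVirasoroWord m x) (hl : l = m - n) :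
      IsVirasoroWord l (A.L n x)

variable (A) in
/-- The span of the Virasoro words of weight `l`. -/
def wordSpan (l : ℤ) : Submodule ℂ V := Submodule.span ℂ {x | A.IsVirasoroWord l x}

theorem L_mem_wordSpan_of_le {l n : ℤ} (hn : n ≤ -2) {x : V} (hx : x ∈ A.wordSpan l) :
    A.L n x ∈ A.wordSpan (l - n) := by
  suffices A.wordSpan l ≤ (A.wordSpan (l - n)).comap (A.L n) from this hx
  exact Submodule.span_le.2 fun y hy => Submodule.subset_span (IsVirasoroWord.L hn hy rfl)

/-- Commuting `Lₙ` past the leftmost letter leaves only terms in which some `L` acts on the shorter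
word, plus a multiple of that word. Letters `L₋₁` are not needed because `L₋₁1 = 0`. -/
theorem IsVirasoroWord.L_mem_wordSpan {l : ℤ} {x : V} (hx : A.IsVirasoroWord l x) :
    ∀ n : ℤ, A.L n x ∈ A.wordSpan (l - n) := by
  induction hx with
  | vac =>
    intro n
    rcases le_or_gt n (-2) with hn | hn
    · exact Submodule.subset_span (.L hn .vac rfl)
    · rw [A.L_vac (by omega)]
      exact zero_mem _
  | @L l m k x hk hx hl ih =>
    intro n
    subst hl
    rw [A.L_L]
    refine add_mem (add_mem ?_ ?_) ?_
    · have := L_mem_wordSpan_of_le hk (ih n)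
      rwa [sub_right_comm] at this
    · have := ih (n + k)
      rw [sub_add_eq_sub_sub_swap] at this
      exact Submodule.smul_mem _ _ this
    · split_ifs with h0
      · refine Submodule.smul_mem _ _ ?_
        rw [show m - k - n = m by omega]
        exact Submodule.subset_span hx
      · exact zero_mem _

theorem virasoroSpan_vac_le : A.virasoroSpan A.vac ≤ ⨆ l, A.wordSpan l := by
  refine sInf_le ⟨Submodule.mem_iSup_of_mem 0 (Submodule.subset_span .vac), fun n y hy => ?_⟩
  suffices (⨆ l, A.wordSpan l) ≤ (⨆ l, A.wordSpan l).comap (A.L n) from this hy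
  exact iSup_le fun l => Submodule.span_le.2 fun x hx =>
    Submodule.mem_iSup_of_mem (l - n) (IsVirasoroWord.L_mem_wordSpan hx n)

theorem IsVirasoroWord.mem_grade {l : ℤ} {x : V} (hx : A.IsVirasoroWord l x) : x ∈ A.grade l := by
  induction hx with
  | vac => exact A.vac_mem_grade
  | L _ _ hl ih => exact A.L_mem_grade ih hl

/-- Words are homogeneous, so by independence of the grading the words of other weights contribute
zero. -/
theorem mem_wordSpan_of_mem_virasoroSpan {l : ℤ} {x : V} (hx : x ∈ A.grade l)
    (hx' : x ∈ A.virasoroSpan A.vac) : x ∈ A.wordSpan l := by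
  have hle : ∀ k, A.wordSpan k ≤ A.grade k := fun k =>
    Submodule.span_le.2 fun y hy => IsVirasoroWord.mem_grade hy
  have hind : iSupIndep A.grade := A.grading.submodule_iSupIndep
  have h : x ∈ A.wordSpan l ⊔ ⨆ k, ⨆ (_ : k ≠ l), A.wordSpan k := by
    refine (iSup_le fun k => ?_ : (⨆ k, A.wordSpan k) ≤ _) (virasoroSpan_vac_le hx')
    rcases eq_or_ne k l with rfl | hk
    · exact le_sup_left
    · exact le_sup_of_le_right (le_iSup₂_of_le k hk le_rfl)
  obtain ⟨y, hy, z, hz, rfl⟩ := Submodule.mem_sup.1 h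
  have hz1 : z ∈ A.grade l := by simpa using sub_mem hx (hle l hy)
  have hz2 : z ∈ ⨆ k, ⨆ (_ : k ≠ l), A.grade k :=
    iSup₂_mono (fun k _ => hle k) hz
  rw [Submodule.disjoint_def.1 (hind l) z hz1 hz2, add_zero]
  exact hy

namespace IsVirasoroWord

theorem nonneg {l : ℤ} {x : V} (hx : A.IsVirasoroWord l x) : 0 ≤ l := by
  induction hx with
  | vac => exact le_rfl
  | L hn _ hl ih => omega

theorem eq_of_zero {l : ℤ} {x : V} (hx : A.IsVirasoroWord l x) (hl : l = 0) : x = A.vac := by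
  cases hx with
  | vac => rfl
  | L hn hy hl' =>
    have := hy.nonneg
    omega

theorem ne_one {l : ℤ} {x : V} (hx : A.IsVirasoroWord l x) : l ≠ 1 := by
  rintro rfl
  cases hx with
  | L hn hy hl' =>
    have := hy.nonneg
    omega

theorem eq_of_two {l : ℤ} {x : V} (hx : A.IsVirasoroWord l x) (hl : l = 2) :
    x = A.L (-2) A.vac := by
  cases hx with
  | vac => omega
  | @L _ m n y hn hy hl' =>
    have := hy.nonneg
    obtain ⟨rfl, rfl⟩ : n = -2 ∧ m = 0 := by omega
    rw [hy.eq_of_zero rfl]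

theorem eq_of_three {l : ℤ} {x : V} (hx : A.IsVirasoroWord l x) (hl : l = 3) :
    x = A.L (-3) A.vac := by
  cases hx with
  | vac => omega
  | @L _ m n y hn hy hl' =>
    have := hy.nonneg
    have := hy.ne_one
    obtain ⟨rfl, rfl⟩ : n = -3 ∧ m = 0 := by omega
    rw [hy.eq_of_zero rfl]

theorem eq_of_four {l : ℤ} {x : V} (hx : A.IsVirasoroWord l x) (hl : l = 4) :
    x = A.L (-4) A.vac ∨ x = A.L (-2) (A.L (-2) A.vac) := by
  cases hx with
  | vac => omega
  | @L _ m n y hn hy hl' =>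
    have := hy.nonneg
    have := hy.ne_one
    obtain ⟨rfl, rfl⟩ | ⟨rfl, rfl⟩ : n = -4 ∧ m = 0 ∨ n = -2 ∧ m = 2 := by omega
    · rw [hy.eq_of_zero rfl]
      exact .inl rfl
    · rw [hy.eq_of_two rfl]
      exact .inr rfl

/-- There is no word of weight 1, which excludes the leading letter `L₋₅`. Letters are not ordered,
so both `L₋₄L₋₂1` and `L₋₂L₋₄1` occur. -/
theorem eq_of_six {l : ℤ} {x : V} (hx : A.IsVirasoroWord l x) (hl : l = 6) :
    x = A.L (-6) A.vac ∨ x = A.L (-4) (A.L (-2) A.vac) ∨ x = A.L (-3) (A.L (-3) A.vac) ∨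
      x = A.L (-2) (A.L (-4) A.vac) ∨ x = A.L (-2) (A.L (-2) (A.L (-2) A.vac)) := by
  cases hx with
  | vac => omega
  | @L _ m n y hn hy hl' =>
    have := hy.nonneg
    have := hy.ne_one
    obtain ⟨rfl, rfl⟩ | ⟨rfl, rfl⟩ | ⟨rfl, rfl⟩ | ⟨rfl, rfl⟩ :
      n = -6 ∧ m = 0 ∨ n = -4 ∧ m = 2 ∨ n = -3 ∧ m = 3 ∨ n = -2 ∧ m = 4 := by omega
    · rw [hy.eq_of_zero rfl]
      exact .inl rfl
    · rw [hy.eq_of_two rfl]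
      exact .inr (.inl rfl)
    · rw [hy.eq_of_three rfl]
      exact .inr (.inr (.inl rfl))
    · rcases hy.eq_of_four rfl with rfl | rfl
      · exact .inr (.inr (.inr (.inl rfl)))
      · exact .inr (.inr (.inr (.inr rfl)))

end IsVirasoroWord

theorem exists_of_mem_wordSpan_four {x : V} (hx : x ∈ A.wordSpan 4) :
    ∃ r s : ℂ, x = r • A.L (-4) A.vac + s • A.L (-2) (A.L (-2) A.vac) := by
  have h : x ∈ Submodule.span ℂ {A.L (-4) A.vac, A.L (-2) (A.L (-2) A.vac)} :=
    Submodule.span_mono (fun y hy => by simpa using IsVirasoroWord.eq_of_four hy rfl) hx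
  obtain ⟨r, s, h⟩ := Submodule.mem_span_pair.1 h
  exact ⟨r, s, h.symm⟩

theorem exists_of_mem_wordSpan_six {x : V} (hx : x ∈ A.wordSpan 6) :
    ∃ r s t u : ℂ, x = r • A.L (-6) A.vac + s • A.L (-4) (A.L (-2) A.vac) +
      t • A.L (-3) (A.L (-3) A.vac) + u • A.L (-2) (A.L (-2) (A.L (-2) A.vac)) := by
  induction hx using Submodule.span_induction with
  | mem y hy =>
    rcases IsVirasoroWord.eq_of_six hy rfl with rfl | rfl | rfl | rfl | rfl
    · exact ⟨1, 0, 0, 0, by module⟩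
    · exact ⟨0, 1, 0, 0, by module⟩
    · exact ⟨0, 0, 1, 0, by module⟩
    -- `[L₋₂, L₋₄] = 2L₋₆`.
    · refine ⟨2, 1, 0, 0, ?_⟩
      rw [A.L_L]
      norm_num
      abel
    · exact ⟨0, 0, 0, 1, by module⟩
  | zero => exact ⟨0, 0, 0, 0, by module⟩
  | add y z _ _ hy hz =>
    obtain ⟨r, s, t, u, rfl⟩ := hy
    obtain ⟨r', s', t', u', rfl⟩ := hz
    exact ⟨r + r', s + s', t + t', u + u', by module⟩
  | smul k y _ hy =>
    obtain ⟨r, s, t, u, rfl⟩ := hy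
    exact ⟨k * r, k * s, k * t, k * u, by module⟩

/-! ### The projection to `M̄(0)` and the design condition. -/

namespace HighestWeightDecomposition

variable {ι : Type*} (D : A.HighestWeightDecomposition ι)

/-- A highest weight vector of weight 0 lies in `V_0 = ℂ1`. -/
theorem isotypic_zero_le : D.isotypic 0 ≤ A.virasoroSpan A.vac := by
  refine iSup₂_le fun i (hi : D.weight i = 0) => sInf_le ⟨?_, fun n y hy =>
    A.L_mem_virasoroSpan hy n⟩
  have h : D.vec i ∈ A.grade 0 := by
    rw [mem_grade]
    simpa [hi] using (D.isHighestWeight i).1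
  rw [grade_zero, Submodule.mem_span_singleton] at h
  obtain ⟨r, hr⟩ := h
  rw [← hr]
  exact Submodule.smul_mem _ _ (Submodule.mem_sInf.2 fun W hW => hW.1)

theorem proj_mem_wordSpan {l : ℤ} {x : V} (hx : x ∈ A.grade l) : D.proj x ∈ A.wordSpan l :=
  mem_wordSpan_of_mem_virasoroSpan (D.proj_mem_grade hx)
    (D.isotypic_zero_le (Submodule.projection_apply_mem D.isCompl x))

theorem proj_L (n : ℤ) (x : V) : D.proj (A.L n x) = A.L n (D.proj x) := by
  have h := Submodule.projection_add_projection_eq_self D.isCompl x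
  have h1 := D.L_mem_isotypic (Submodule.projection_apply_mem D.isCompl x) n
  have h2 := D.L_mem_positivePart (Submodule.projection_apply_mem D.isCompl.symm x) n
  conv_lhs => rw [← h]
  rw [map_add, map_add]
  simp only [proj]
  rw [Submodule.projection_apply_of_mem_left D.isCompl h1,
    (Submodule.projection_apply_eq_zero_iff D.isCompl).2 h2, add_zero]

variable {D}

theorem IsConformalDesign.zeroModeTrace_proj {t : ℕ} {k : ℤ} (h : D.IsConformalDesign t k) {n : ℕ}
    (hn : n ≤ t) {m : ℤ} (hm : (n : ℤ) = m) {v : V} (hv : v ∈ A.grade m) :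
    A.zeroModeTrace m k ⟨v, hv⟩ = A.zeroModeTrace m k ⟨D.proj v, D.proj_mem_grade hv⟩ := by
  subst hm
  exact h n hn ⟨v, hv⟩

/-- A conformal `t`-design on a nonzero space forces `π(1) = 1`. -/
theorem IsConformalDesign.proj_vac {t : ℕ} {k : ℤ} (h : D.IsConformalDesign t k)
    (hk : A.grade k ≠ ⊥) : D.proj A.vac = A.vac := by
  have hfin : FiniteDimensional ℂ (A.grade k) := A.finite k
  have hp : D.proj A.vac ∈ A.grade 0 := D.proj_mem_grade A.vac_mem_grade
  rw [grade_zero, Submodule.mem_span_singleton] at hp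
  obtain ⟨r, hr⟩ := hp
  -- With `π(1) = r1` and `o(1) = id`, the design condition in weight 0 reads `dim V_k = r dim V_k`.
  have h0 := h 0 (Nat.zero_le t) ⟨A.vac, A.vac_mem_grade⟩
  have e1 : A.zeroMode ((0 : ℕ) : ℤ) k ⟨A.vac, A.vac_mem_grade⟩ = LinearMap.id := by
    ext w
    simp [zeroMode, mode_vac_apply]
  have e2 : A.zeroMode ((0 : ℕ) : ℤ) k ⟨D.proj A.vac, D.proj_mem_grade A.vac_mem_grade⟩ =
      r • LinearMap.id := by
    ext w
    simp [zeroMode, ← hr, A.mode_smul, mode_vac_apply]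
  rw [e1, e2, map_smul, LinearMap.trace_id, smul_eq_mul] at h0
  have hd : (Module.finrank ℂ (A.grade k) : ℂ) ≠ 0 := by
    rw [Nat.cast_ne_zero]
    exact fun h' => hk (Submodule.finrank_eq_zero.1 h')
  have hr1 : r = 1 := mul_right_cancel₀ hd (by rw [← h0, one_mul])
  rw [← hr, hr1, one_smul]

end HighestWeightDecomposition

/-! ### Gram equations at levels 4 and 6, and their right-hand sides. -/

/-- The Gram equations for the level 4 part of the Virasoro module generated by the vacuum. -/
theorem gram_four (r s : ℂ) :
    A.L 4 (r • A.L (-4) A.vac + s • A.L (-2) (A.L (-2) A.vac)) =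
      (r * (5 * c) + s * (3 * c)) • A.vac ∧
    A.L 2 (A.L 2 (r • A.L (-4) A.vac + s • A.L (-2) (A.L (-2) A.vac))) =
      (r * (3 * c) + s * (4 * c + c ^ 2 / 2)) • A.vac := by
  constructor
  · simp [A.L_L_of_le, A.L_vac]
    module
  · simp [A.L_L_of_le, A.L_vac]
    module

/-- The Gram equations for the level 6 part of the Virasoro module generated by the vacuum. -/
theorem gram_six (r s t u : ℂ) {x : V}
    (hx : x = r • A.L (-6) A.vac + s • A.L (-4) (A.L (-2) A.vac) +
      t • A.L (-3) (A.L (-3) A.vac) + u • A.L (-2) (A.L (-2) (A.L (-2) A.vac))) :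
    A.L 6 x = (r * (35 / 2 * c) + s * (5 * c) + t * (18 * c) + u * (24 * c)) • A.vac ∧
    A.L 2 (A.L 4 x) = (r * (5 * c) + s * (8 * c + 5 / 2 * c ^ 2) + t * (14 * c) +
      u * (24 * c + 9 / 2 * c ^ 2)) • A.vac ∧
    A.L 3 (A.L 3 x) = (r * (18 * c) + s * (14 * c) + t * (36 * c + 8 * c ^ 2) +
      u * (30 * c)) • A.vac ∧
    A.L 2 (A.L 2 (A.L 2 x)) = (r * (24 * c) + s * (24 * c + 9 / 2 * c ^ 2) + t * (30 * c) +
      u * (96 * c + 18 * c ^ 2 + 3 / 4 * c ^ 3)) • A.vac := by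
  subst hx
  refine ⟨?_, ?_, ?_, ?_⟩
  · simp [A.L_L_of_le, A.L_vac]
    module
  · simp [A.L_L_of_le, A.L_vac]
    module
  · simp [A.L_L_of_le, A.L_vac]
    module
  · simp [A.L_L_of_le, A.L_vac]
    module

section Pair

variable {a b : V} {e f : ℂ}

theorem mode_vac_eq_zero {n : ℤ} (hn : 0 ≤ n) (a : V) : A.mode a n A.vac = 0 := A.mode_vac a n hn

theorem isVirasoro_apply (ha : A.IsVirasoro a e) (m n : ℤ) (x : V) :
    A.mode a (m + 1) (A.mode a (n + 1) x) = A.mode a (n + 1) (A.mode a (m + 1) x) +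
      ((m : ℂ) - n) • A.mode a (m + n + 1) x +
      if m + n = 0 then ((((m : ℂ) ^ 3 - m) / 12) * e) • x else 0 := by
  have h := congrArg (fun f : Module.End ℂ V => f x) (ha m n)
  simp only [LinearMap.sub_apply, Module.End.mul_apply, LinearMap.add_apply, LinearMap.smul_apply,
    sub_eq_iff_eq_add] at h
  rw [h]
  split_ifs <;> simp <;> abel

/-- The commutation rule for the modes of a Virasoro vector, in normally ordered form. -/
theorem isVirasoro_apply_of_le (ha : A.IsVirasoro a e) {m n : ℤ} (_hm : 0 ≤ m) (_hn : n ≤ -1)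
    (x : V) :
    A.mode a m (A.mode a n x) = A.mode a n (A.mode a m x) +
      ((m : ℂ) - n) • A.mode a (m + n - 1) x +
      if m + n = 2 then (((((m : ℂ) - 1) ^ 3 - (m - 1)) / 12) * e) • x else 0 := by
  have h := isVirasoro_apply ha (m - 1) (n - 1) x
  rw [sub_add_cancel, sub_add_cancel] at h
  rw [h, show m - 1 + (n - 1) + 1 = m + n - 1 by ring]
  simp only [show m - 1 + (n - 1) = 0 ↔ m + n = 2 by omega]
  push_cast
  rw [sub_sub_sub_cancel_right]

theorem mode_mode_of_le (hcomm : ∀ m n : ℤ, A.mode a m * A.mode b n = A.mode b n * A.mode a m)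
    {m n : ℤ} (_hm : 0 ≤ m) (_hn : n ≤ -1) (x : V) :
    A.mode a m (A.mode b n x) = A.mode b n (A.mode a m x) :=
  congrArg (fun f : Module.End ℂ V => f x) (hcomm m n)

theorem L_apply_of_add (hab : A.conf = a + b) (n : ℤ) (x : V) :
    A.L n x = A.mode a (n + 1) x + A.mode b (n + 1) x := by
  rw [L, hab, A.mode_add, LinearMap.add_apply]

theorem L_mode_neg_one (hab : A.conf = a + b) (ha : A.IsVirasoro a e) (hb : A.IsVirasoro b f)
    (hcomm : ∀ m n : ℤ, A.mode a m * A.mode b n = A.mode b n * A.mode a m) :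
    A.L 4 (A.mode a (-1) (A.mode b (-1) A.vac)) = (0 : ℂ) • A.vac ∧
    A.L 2 (A.L 2 (A.mode a (-1) (A.mode b (-1) A.vac))) = (e * f / 2) • A.vac := by
  have h1 := fun {m n : ℤ} (hm : 0 ≤ m) (hn : n ≤ -1) (x : V) =>
    mode_mode_of_le (A := A) hcomm hm hn x
  have h2 := fun {m n : ℤ} (hm : 0 ≤ m) (hn : n ≤ -1) (x : V) =>
    mode_mode_of_le (A := A) (fun m n => (hcomm n m).symm) hm hn x
  constructor
  · simp [L_apply_of_add hab, isVirasoro_apply_of_le ha, isVirasoro_apply_of_le hb, h1, h2,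
      mode_vac_eq_zero]
  · simp [L_apply_of_add hab, isVirasoro_apply_of_le ha, isVirasoro_apply_of_le hb, h1, h2,
      mode_vac_eq_zero]
    module

/-- With `Lₙ = a₍ₙ₊₁₎ + b₍ₙ₊₁₎`, a nonzero result requires the central terms of both `a₍₄₎a₍₋₂₎` and
`b₍₄₎b₍₋₂₎`. Only `L₃L₃` supplies both modes, giving `2 · (2e)(2f)`. -/
theorem L_mode_neg_two (hab : A.conf = a + b) (ha : A.IsVirasoro a e) (hb : A.IsVirasoro b f)
    (hcomm : ∀ m n : ℤ, A.mode a m * A.mode b n = A.mode b n * A.mode a m) :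
    A.L 6 (A.mode a (-2) (A.mode b (-2) A.vac)) = (0 : ℂ) • A.vac ∧
    A.L 2 (A.L 4 (A.mode a (-2) (A.mode b (-2) A.vac))) = (0 : ℂ) • A.vac ∧
    A.L 3 (A.L 3 (A.mode a (-2) (A.mode b (-2) A.vac))) = (8 * e * f) • A.vac ∧
    A.L 2 (A.L 2 (A.L 2 (A.mode a (-2) (A.mode b (-2) A.vac)))) = (0 : ℂ) • A.vac := by
  have h1 := fun {m n : ℤ} (hm : 0 ≤ m) (hn : n ≤ -1) (x : V) =>
    mode_mode_of_le (A := A) hcomm hm hn x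
  have h2 := fun {m n : ℤ} (hm : 0 ≤ m) (hn : n ≤ -1) (x : V) =>
    mode_mode_of_le (A := A) (fun m n => (hcomm n m).symm) hm hn x
  refine ⟨?_, ?_, ?_, ?_⟩
  · simp [L_apply_of_add hab, isVirasoro_apply_of_le ha, isVirasoro_apply_of_le hb, h1, h2,
      mode_vac_eq_zero]
  · simp [L_apply_of_add hab, isVirasoro_apply_of_le ha, isVirasoro_apply_of_le hb, h1, h2,
      mode_vac_eq_zero]
  · simp [L_apply_of_add hab, isVirasoro_apply_of_le ha, isVirasoro_apply_of_le hb, h1, h2,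
      mode_vac_eq_zero]
    module
  · simp [L_apply_of_add hab, isVirasoro_apply_of_le ha, isVirasoro_apply_of_le hb, h1, h2,
      mode_vac_eq_zero]

end Pair

/-- The linear algebra behind the dimension formula: `p, q` and `r, s, t, u` are the coordinates of
the projections of `a₍₋₁₎ b` and `a₍₋₂₎ b₍₋₂₎ 1` to `M̄(0)`, and `x` is the product of the central
charges of `a` and `b`. -/
theorem dimension_formula_of_gram {c x d : ℂ} (hx : x ≠ 0)
    (hD : 748 - 55 * c + c ^ 2 ≠ 0) (p q r s t u : ℂ)
    (p1 : p * (5 * c) + q * (3 * c) = 0)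
    (p2 : p * (3 * c) + q * (4 * c + c ^ 2 / 2) = x / 2)
    (q1 : r * (35 / 2 * c) + s * (5 * c) + t * (18 * c) + u * (24 * c) = 0)
    (q2 : r * (5 * c) + s * (8 * c + 5 / 2 * c ^ 2) + t * (14 * c) +
      u * (24 * c + 9 / 2 * c ^ 2) = 0)
    (q3 : r * (18 * c) + s * (14 * c) + t * (36 * c + 8 * c ^ 2) + u * (30 * c) = 8 * x)
    (q4 : r * (24 * c) + s * (24 * c + 9 / 2 * c ^ 2) + t * (30 * c) +
      u * (96 * c + 18 * c ^ 2 + 3 / 4 * c ^ 3) = 0)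
    (h : r * (10 * d) + s * (16 * d + 5 * c) + t * (28 * d) + u * (48 * d + 9 * c) =
      4 * (p * (6 * d) + q * (8 * d + c))) :
    d = c * (2388 + 955 * c + 70 * c ^ 2) / (2 * (748 - 55 * c + c ^ 2)) := by
  have key : c * (5 * c + 22) * (2 * c - 1) * (7 * c + 68) * t =
      8 * x * (128 + 100 * c + 35 / 4 * c ^ 2) := by
    linear_combination (-160 - 94 * c - 9 * c ^ 2) * q1 + (-496 - 31 * c) * q2 +
      (128 + 100 * c + 35 / 4 * c ^ 2) * q3 + 124 * q4
  -- At each root of the left factor in `key` the quadratic on the right is nonzero, so the level 6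
  -- system has no solution there.
  have hK : c * (5 * c + 22) * (2 * c - 1) * (7 * c + 68) ≠ 0 := by
    intro hK
    rw [hK, zero_mul, eq_comm, mul_eq_zero, or_iff_right (by simpa using hx)] at key
    rcases mul_eq_zero.1 hK with hK | hK
    · rcases mul_eq_zero.1 hK with hK | hK
      · rcases mul_eq_zero.1 hK with hK | hK
        · norm_num [hK] at key
        · have : c = -22 / 5 := by linear_combination hK / 5
          norm_num [this] at key
      · have : c = 1 / 2 := by linear_combination hK / 2
        norm_num [this] at key
    · have : c = -68 / 7 := by linear_combination hK / 7
      norm_num [this] at key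
  -- The multipliers of `q1`–`q4` write the trace functional, scaled by the determinant factor, as a
  -- combination of the rows of the level 6 Gram matrix; those of `p1`, `p2` do the same at level 4.
  -- All coordinates cancel without any division, and only the right-hand sides of `p2` and `q3`
  -- remain.
  have hfinal : x * (2 * (748 - 55 * c + c ^ 2) * d - c * (2388 + 955 * c + 70 * c ^ 2)) = 0 := by
    linear_combination (1 / 4 : ℂ) * (c * (5 * c + 22) * (2 * c - 1) * (7 * c + 68) * h -
      (d - 1) * (-1824 * c + 280 * c ^ 2 + 40 * c ^ 3) * q1 -
      (d * (-2992 + 1708 * c + 368 * c ^ 2) + (3288 * c + 1538 * c ^ 2 + 140 * c ^ 3)) * q2 -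
      (d - 1) * (1364 * c + 155 * c ^ 2) * q3 - (d - 1) * (992 * c) * q4 +
      4 * (2 * c - 1) * (7 * c + 68) * ((d - 1) * (6 * c) * p1 + (44 * d + 10 * c) * p2))
  rw [eq_div_iff (mul_ne_zero two_ne_zero hD)]
  have := (mul_eq_zero.1 hfinal).resolve_left hx
  linear_combination this

theorem zeroModeTrace_of_eq_four (hV1 : A.grade 1 = ⊥) {x : V} (hx : x ∈ A.grade 4) (r s : ℂ)
    (h : x = r • A.L (-4) A.vac + s • A.L (-2) (A.L (-2) A.vac)) :
    A.zeroModeTrace 4 2 ⟨x, hx⟩ = r * (6 * Module.finrank ℂ (A.grade 2)) +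
      s * (8 * Module.finrank ℂ (A.grade 2) + c) := by
  rw [zeroModeTrace_eq_of_L _ (r * 6 + s * 8) (s * 2)]
  · ring
  · intro w hw
    subst h
    simp only [A.mode_add, A.mode_smul, LinearMap.add_apply, LinearMap.smul_apply]
    norm_num only [mode_L_neg_four_vac_apply hV1 hw, mode_L_neg_two_L_neg_two_vac_apply hV1 hw]
    module

theorem zeroModeTrace_of_eq_six (hV1 : A.grade 1 = ⊥) {x : V} (hx : x ∈ A.grade 6)
    (r s t u : ℂ)
    (h : x = r • A.L (-6) A.vac + s • A.L (-4) (A.L (-2) A.vac) +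
      t • A.L (-3) (A.L (-3) A.vac) + u • A.L (-2) (A.L (-2) (A.L (-2) A.vac))) :
    A.zeroModeTrace 6 2 ⟨x, hx⟩ = r * (10 * Module.finrank ℂ (A.grade 2)) +
      s * (16 * Module.finrank ℂ (A.grade 2) + 5 * c) +
      t * (28 * Module.finrank ℂ (A.grade 2)) +
      u * (48 * Module.finrank ℂ (A.grade 2) + 9 * c) := by
  rw [zeroModeTrace_eq_of_L _ (r * 10 + s * 16 + t * 28 + u * 48) (s * 10 + u * 18)]
  · ring
  · intro w hw
    subst h
    simp only [A.mode_add, A.mode_smul, LinearMap.add_apply, LinearMap.smul_apply]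
    norm_num only [mode_L_neg_six_vac_apply hV1 hw, mode_L_neg_four_L_neg_two_vac_apply hV1 hw,
      mode_L_neg_three_L_neg_three_vac_apply hV1 hw, mode_L_neg_two_cube_vac_apply hV1 hw]
    module

end VertexOperatorAlgebra

open VertexOperatorAlgebra in
/-- The dimension formula for a conformal 6-design `V_2` with a splitting `ω = a + b` of the
Virasoro vector into commuting Virasoro vectors. -/
theorem finrank_grade_two_of_isConformalDesign {c : ℂ} {V : Type*} [AddCommGroup V] [Module ℂ V]
    {A : VertexOperatorAlgebra c V} {ι : Type*} (D : A.HighestWeightDecomposition ι)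
    (hD : 748 - 55 * c + c ^ 2 ≠ 0) (hV1 : A.grade 1 = ⊥) {a b : V} {e f : ℂ}
    (ha : a ∈ A.grade 2) (hb : b ∈ A.grade 2) (hab : A.conf = a + b)
    (hvira : A.IsVirasoro a e) (hvirb : A.IsVirasoro b f) (he : e ≠ 0) (hf : f ≠ 0)
    (hcomm : ∀ m n : ℤ, A.mode a m * A.mode b n = A.mode b n * A.mode a m)
    (hdesign : D.IsConformalDesign 6 2) :
    (Module.finrank ℂ (A.grade 2) : ℂ) =
      c * (2388 + 955 * c + 70 * c ^ 2) / (2 * (748 - 55 * c + c ^ 2)) := by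
  have hpv : D.proj A.vac = A.vac := hdesign.proj_vac fun h => A.conf_ne_zero <| by
    have := A.conf_mem_grade
    simpa [h] using this
  have hm4 := mode_neg_one_mem_grade ha hb
  have hm6 := mode_neg_two_mem_grade ha hb
  have hT4 := hdesign.zeroModeTrace_proj (n := 4) (by norm_num) (by norm_num) hm4
  have hT6 := hdesign.zeroModeTrace_proj (n := 6) (by norm_num) (by norm_num) hm6
  have hT := zeroModeTrace_six_eq_four_mul hcomm hV1 ha hb
  obtain ⟨p, q, hpq⟩ := exists_of_mem_wordSpan_four (D.proj_mem_wordSpan hm4)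
  obtain ⟨r, s, t, u, hrs⟩ := exists_of_mem_wordSpan_six (D.proj_mem_wordSpan hm6)
  have hS4 := zeroModeTrace_of_eq_four hV1 (D.proj_mem_grade hm4) p q hpq
  have hS6 := zeroModeTrace_of_eq_six hV1 (D.proj_mem_grade hm6) r s t u hrs
  have hinj : Function.Injective fun k : ℂ => k • A.vac := smul_left_injective ℂ A.vac_ne_zero
  obtain ⟨l4, l22⟩ := L_mode_neg_one hab hvira hvirb hcomm
  rw [show A.mode b (-1) A.vac = b from A.mode_neg_one_vac b] at l4 l22
  obtain ⟨l6, l24, l33, l222⟩ := L_mode_neg_two hab hvira hvirb hcomm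
  obtain ⟨g4, g22⟩ := gram_four (A := A) p q
  obtain ⟨g6, g24, g33, g222⟩ := gram_six r s t u hrs
  rw [← hpq] at g4 g22
  -- Pulling `π` out of the `Lₙ` reduces each left-hand side to a known multiple of `π(1) = 1`;
  -- comparing coefficients of `1` then gives the scalar equations.
  simp only [← D.proj_L, l4, l22, map_smul, hpv] at g4 g22
  simp only [← D.proj_L, l6, l24, l33, l222, map_smul, hpv] at g6 g24 g33 g222
  refine dimension_formula_of_gram (x := e * f) (mul_ne_zero he hf) hD p q r s t u
    (hinj g4.symm) (hinj g22.symm) (hinj g6.symm) (hinj g24.symm)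
    ((hinj g33.symm).trans (by ring)) (hinj g222.symm) ?_
  rw [← hS4, ← hS6, ← hT4, ← hT6]
  exact hT

end
theorem proposition4p5 {V : Type*} [AddCommGroup V] [Module ℂ V] {ι : Type*} {c : ℂ}
    (A : VertexOperatorAlgebra c V) (D : A.HighestWeightDecomposition ι)
    (hc1 : c ≠ -24) (hc2 : c ≠ -15) (hc3 : c ≠ -44 / 5) (hc4 : c ≠ 34 / 35)
    (hc5 : c ≠ (55 + (Real.sqrt 33 : ℂ)) / 2) (hc6 : c ≠ (55 - (Real.sqrt 33 : ℂ)) / 2)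
    (hc7 : c ≠ 1)
    (hV1 : A.grade 1 = ⊥)
    (ω' : V) (e : ℂ)
    (hω' : ω' ∈ A.grade 2) (hω'' : A.conf - ω' ∈ A.grade 2)
    (hvir' : A.IsVirasoro ω' e) (hvir'' : A.IsVirasoro (A.conf - ω') (c - e))
    (hcomm : A.Commuting (A.generated ω') (A.generated (A.conf - ω')))
    (he1 : e ≠ -68 / 7) (he2 : e ≠ -22 / 5) (he3 : e ≠ 0)
    (hce1 : c - e ≠ -68 / 7) (hce2 : c - e ≠ -22 / 5) (hce3 : c - e ≠ 0)
    (hsimple' : e = 1 / 2 → A.IsSimpleSubalgebra (A.generated ω'))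
    (hsimple'' : e = c - 1 / 2 → A.IsSimpleSubalgebra (A.generated (A.conf - ω')))
    (hdesign : D.IsConformalDesign 6 2) :
    (Module.finrank ℂ (A.grade 2) : ℂ) =
      c * (2388 + 955 * c + 70 * c ^ 2) / (2 * (748 - 55 * c + c ^ 2)) := by
  have hsq : (Real.sqrt 33 : ℂ) ^ 2 = 33 := by
    rw [← Complex.ofReal_pow, Real.sq_sqrt (by norm_num)]
    norm_num
  have hD : 748 - 55 * c + c ^ 2 ≠ 0 := by
    intro h
    -- The excluded values `(55 ± √33)/2` are exactly the roots of the denominator.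
    have h2 : (c - (55 + (Real.sqrt 33 : ℂ)) / 2) * (c - (55 - (Real.sqrt 33 : ℂ)) / 2) = 0 := by
      linear_combination h - hsq / 4
    rcases mul_eq_zero.1 h2 with h3 | h3
    · exact hc5 (sub_eq_zero.1 h3)
    · exact hc6 (sub_eq_zero.1 h3)
  have hgen : ∀ x : V, x ∈ A.generated x := fun x => Submodule.mem_sInf.2 fun U hU => hU.2
  exact finrank_grade_two_of_isConformalDesign D hD hV1 hω' hω'' (add_sub_cancel _ _).symm hvir'
    hvir'' he3 hce3 (hcomm _ (hgen _) _ (hgen _)) hdesign
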